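/- Let $D$ be a Dedekind domain with field of fractions $K$, let $\operatorname{Int}(D) = \{f \in K[X] : f(D) \subseteq D\}$, let $\mathfrak m$ be a nonzero maximal ideal of $D$ with finite residue field $D/\mathfrak m$ (so that $D$ is not a field), and let $\widehat{D}_{\mathfrak m}$ be the $\mathfrak m$-adic completion of $D$. There is a unique $D$-$D$-biring structure on the $D$-algebra $\operatorname{Int}(D)$ (that is, a structure of a $D$-algebra object in the opposite of the category of commutative $D$-algebras) such that the inclusion $D[X] \longrightarrow \operatorname{Int}(D)$ is a homomorphism of $D$-$D$-birings, where on $D[X]$ co-addition is $X \longmapsto X \otimes 1 + 1 \otimes X$, co-multiplication is $X \longmapsto X \otimes X$, and the co-$D$-linear structure is $a \longmapsto (f \longmapsto f(a))$. For every commutative $D$-algebra $A$, equip the set $\operatorname{Hom}_D(\operatorname{Int}(D), A)$ of $D$-algebra homomorphisms with the $D$-algebra structure induced by this biring structure. Identify $\widehat{D}_{\mathfrak m}/\mathfrak m \widehat{D}_{\mathfrak m}$ with $D/\mathfrak m$ through the canonical isomorphism. For $f \in \operatorname{Int}(D)$ and $\alpha \in \widehat{D}_{\mathfrak m}$ one has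 $f(\alpha) \in \widehat{D}_{\mathfrak m}$, and the map $$\widehat{D}_{\mathfrak m} \longrightarrow \operatorname{Hom}_D(\operatorname{Int}(D), D/\mathfrak m), \qquad \alpha \longmapsto (f \longmapsto f(\alpha) \bmod \mathfrak m \widehat{D}_{\mathfrak m})$$ is an isomorphism of $D$-algebras. More generally, let $A$ be any $D$-algebra that is a domain with $\mathfrak m A = 0$. Then composition with the structure map $D/\mathfrak m \longrightarrow A$ is a $D$-algebra isomorphism $\operatorname{Hom}_D(\operatorname{Int}(D), D/\mathfrak m) \longrightarrow \operatorname{Hom}_D(\operatorname{Int}(D), A)$; the map $\widehat{D}_{\mathfrak m} \longrightarrow \operatorname{Hom}_D(\operatorname{Int}(D), A)$ that sends $\alpha$ to $f \longmapsto$ (the image in $A$ of $f(\alpha) \bmod \mathfrak m \widehat{D}_{\mathfrak m}$) is a $D$-algebra isomorphism; and the latter is the composition of the two isomorphisms above, so that the triangle formed by these three maps commutes. -/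

import Mathlib

open Polynomial TensorProduct

/-! ### Birings and their algebras of points -/

/-- Given a co-operation `c : S → S ⊗ S`, the operation that it induces on `Hom_A(S, R)`:
if `c s = ∑ sᵢ ⊗ tᵢ`, then `coOp c φ ψ s = ∑ φ sᵢ * ψ tᵢ`. -/
noncomputable def coOp {A S R : Type*} [CommRing A] [CommRing S] [Algebra A S]
    [CommRing R] [Algebra A R] (c : S →ₐ[A] S ⊗[A] S) (φ ψ : S →ₐ[A] R) : S →ₐ[A] R :=
  (Algebra.TensorProduct.productMap φ ψ).comp c

/-- An `A`-`B`-biring structure on an `A`-algebra `S`: a structure on `S` of a `B`-algebra object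
in the opposite of the category of commutative `A`-algebras, given by its co-operations. -/
@[ext]
structure Biring (A B S : Type*) [CommRing A] [CommRing B] [CommRing S] [Algebra A S] where
  /-- co-addition -/
  coadd : S →ₐ[A] S ⊗[A] S
  /-- co-zero -/
  cozero : S →ₐ[A] A
  /-- co-additive inverse -/
  coneg : S →ₐ[A] S
  /-- co-multiplication -/
  comul : S →ₐ[A] S ⊗[A] S
  /-- co-unit -/
  counit : S →ₐ[A] A
  /-- co-`B`-linear structure -/
  colin : B → (S →ₐ[A] A)
  coadd_assoc :
    (Algebra.TensorProduct.assoc A A A S S S).toAlgHom.comp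
      ((Algebra.TensorProduct.map coadd (AlgHom.id A S)).comp coadd) =
    (Algebra.TensorProduct.map (AlgHom.id A S) coadd).comp coadd
  coadd_comm : (Algebra.TensorProduct.comm A S S).toAlgHom.comp coadd = coadd
  cozero_coadd :
    (Algebra.TensorProduct.lid A S).toAlgHom.comp
      ((Algebra.TensorProduct.map cozero (AlgHom.id A S)).comp coadd) = AlgHom.id A S
  coneg_coadd :
    (Algebra.TensorProduct.lmul' A).comp
      ((Algebra.TensorProduct.map coneg (AlgHom.id A S)).comp coadd) =
    (Algebra.ofId A S).comp cozero
  comul_assoc :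
    (Algebra.TensorProduct.assoc A A A S S S).toAlgHom.comp
      ((Algebra.TensorProduct.map comul (AlgHom.id A S)).comp comul) =
    (Algebra.TensorProduct.map (AlgHom.id A S) comul).comp comul
  comul_comm : (Algebra.TensorProduct.comm A S S).toAlgHom.comp comul = comul
  counit_comul :
    (Algebra.TensorProduct.lid A S).toAlgHom.comp
      ((Algebra.TensorProduct.map counit (AlgHom.id A S)).comp comul) = AlgHom.id A S
  /-- co-distributivity: `x * (y + z) = x * y + x * z` for the three universal points `x`, `y`, `z`
  of `S` with values in `S ⊗ (S ⊗ S)`. -/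
  codistrib :
    let x : S →ₐ[A] S ⊗[A] (S ⊗[A] S) := Algebra.TensorProduct.includeLeft
    let y : S →ₐ[A] S ⊗[A] (S ⊗[A] S) :=
      Algebra.TensorProduct.includeRight.comp Algebra.TensorProduct.includeLeft
    let z : S →ₐ[A] S ⊗[A] (S ⊗[A] S) :=
      Algebra.TensorProduct.includeRight.comp Algebra.TensorProduct.includeRight
    coOp comul x (coOp coadd y z) = coOp coadd (coOp comul x y) (coOp comul x z)
  colin_zero : colin 0 = cozero
  colin_one : colin 1 = counit
  colin_add : ∀ a b, colin (a + b) = coOp coadd (colin a) (colin b)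
  colin_mul : ∀ a b, colin (a * b) = coOp comul (colin a) (colin b)

namespace Biring

variable {A B S : Type*} [CommRing A] [CommRing B] [CommRing S] [Algebra A S]

/-- The set `Hom_A(S, R)`, to be equipped with the `B`-algebra structure that is induced by the
biring structure `P` on `S`. -/
@[ext]
structure Points (P : Biring A B S) (R : Type*) [CommRing R] [Algebra A R] where
  /-- the underlying homomorphism of `A`-algebras -/
  toAlgHom : S →ₐ[A] R

section coOp

variable {R R' : Type*} [CommRing R] [Algebra A R] [CommRing R'] [Algebra A R']

theorem comp_coOp (g : R →ₐ[A] R') (c : S →ₐ[A] S ⊗[A] S) (φ ψ : S →ₐ[A] R) :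
    g.comp (coOp c φ ψ) = coOp c (g.comp φ) (g.comp ψ) := by
  unfold coOp
  rw [← AlgHom.comp_assoc]
  congr 1
  ext <;> simp

theorem coOp_assoc {c : S →ₐ[A] S ⊗[A] S}
    (hc : (Algebra.TensorProduct.assoc A A A S S S).toAlgHom.comp
        ((Algebra.TensorProduct.map c (AlgHom.id A S)).comp c) =
      (Algebra.TensorProduct.map (AlgHom.id A S) c).comp c) (φ ψ χ : S →ₐ[A] R) :
    coOp c (coOp c φ ψ) χ = coOp c φ (coOp c ψ χ) := by
  ext s
  have h := congrArg (Algebra.TensorProduct.productMap φ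
    (Algebra.TensorProduct.productMap ψ χ)) (DFunLike.congr_fun hc s)
  simp only [AlgHom.comp_apply] at h
  simp only [coOp, AlgHom.comp_apply]
  generalize c s = t at h ⊢
  calc _ = _ := ?_
    _ = _ := h
    _ = _ := ?_
  · clear h hc
    induction t using TensorProduct.induction_on with
    | zero => simp
    | tmul a b =>
      simp only [Algebra.TensorProduct.productMap_apply_tmul, AlgHom.comp_apply,
        Algebra.TensorProduct.map_tmul, AlgHom.id_apply]
      generalize c a = t
      induction t using TensorProduct.induction_on with
      | zero => simp
      | tmul a b => simp [mul_assoc]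
      | add a b ha hb => simp only [map_add, add_mul, ha, hb, TensorProduct.add_tmul]
    | add a b ha hb => simp only [map_add, ha, hb]
  · clear h hc
    induction t using TensorProduct.induction_on with
    | zero => simp
    | tmul a b => simp
    | add a b ha hb => simp only [map_add, ha, hb]

theorem coOp_comm {c : S →ₐ[A] S ⊗[A] S}
    (hc : (Algebra.TensorProduct.comm A S S).toAlgHom.comp c = c) (φ ψ : S →ₐ[A] R) :
    coOp c φ ψ = coOp c ψ φ := by
  ext s
  have h := congrArg (Algebra.TensorProduct.productMap φ ψ) (DFunLike.congr_fun hc s)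
  simp only [AlgHom.comp_apply] at h
  simp only [coOp, AlgHom.comp_apply]
  rw [← h]
  generalize c s = t
  induction t using TensorProduct.induction_on with
  | zero => simp
  | tmul a b => simp [mul_comm]
  | add a b ha hb => simp only [map_add, ha, hb]

theorem coOp_unit {c : S →ₐ[A] S ⊗[A] S} {e : S →ₐ[A] A}
    (hc : (Algebra.TensorProduct.lid A S).toAlgHom.comp
      ((Algebra.TensorProduct.map e (AlgHom.id A S)).comp c) = AlgHom.id A S) (φ : S →ₐ[A] R) :
    coOp c ((Algebra.ofId A R).comp e) φ = φ := by
  ext s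
  have h := congrArg φ (DFunLike.congr_fun hc s)
  simp only [AlgHom.comp_apply, AlgHom.id_apply] at h
  simp only [coOp, AlgHom.comp_apply]
  refine Eq.trans ?_ h
  generalize c s = t
  induction t using TensorProduct.induction_on with
  | zero => simp
  | tmul a b => simp [Algebra.ofId_apply, Algebra.smul_def]
  | add a b ha hb => simp only [map_add, ha, hb]

theorem coOp_neg {c : S →ₐ[A] S ⊗[A] S} {e : S →ₐ[A] A} {n : S →ₐ[A] S}
    (hc : (Algebra.TensorProduct.lmul' A).comp
      ((Algebra.TensorProduct.map n (AlgHom.id A S)).comp c) = (Algebra.ofId A S).comp e)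
    (φ : S →ₐ[A] R) :
    coOp c (φ.comp n) φ = (Algebra.ofId A R).comp e := by
  ext s
  have h := congrArg φ (DFunLike.congr_fun hc s)
  simp only [AlgHom.comp_apply, Algebra.ofId_apply, AlgHom.commutes] at h
  simp only [coOp, AlgHom.comp_apply, Algebra.ofId_apply]
  refine Eq.trans ?_ h
  generalize c s = t
  induction t using TensorProduct.induction_on with
  | zero => simp
  | tmul a b => simp
  | add a b ha hb => simp only [map_add, ha, hb]

theorem coOp_distrib (P : Biring A B S) (φ ψ χ : S →ₐ[A] R) :
    coOp P.comul φ (coOp P.coadd ψ χ) =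
      coOp P.coadd (coOp P.comul φ ψ) (coOp P.comul φ χ) := by
  have h := congrArg (fun t => (Algebra.TensorProduct.productMap φ
    (Algebra.TensorProduct.productMap ψ χ)).comp t) P.codistrib
  simp only [comp_coOp] at h
  have h1 : (Algebra.TensorProduct.productMap φ (Algebra.TensorProduct.productMap ψ χ)).comp
      Algebra.TensorProduct.includeLeft = φ := by ext; simp
  have h2 : (Algebra.TensorProduct.productMap φ (Algebra.TensorProduct.productMap ψ χ)).comp
      (Algebra.TensorProduct.includeRight.comp Algebra.TensorProduct.includeLeft) = ψ := by
    ext; simp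
  have h3 : (Algebra.TensorProduct.productMap φ (Algebra.TensorProduct.productMap ψ χ)).comp
      (Algebra.TensorProduct.includeRight.comp Algebra.TensorProduct.includeRight) = χ := by
    ext; simp
  rwa [h1, h2, h3] at h

end coOp

namespace Points

variable {P : Biring A B S} {R : Type*} [CommRing R] [Algebra A R]

noncomputable instance : Zero (P.Points R) := ⟨⟨(Algebra.ofId A R).comp P.cozero⟩⟩
noncomputable instance : One (P.Points R) := ⟨⟨(Algebra.ofId A R).comp P.counit⟩⟩
noncomputable instance : Add (P.Points R) := ⟨fun φ ψ => ⟨coOp P.coadd φ.toAlgHom ψ.toAlgHom⟩⟩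
noncomputable instance : Mul (P.Points R) := ⟨fun φ ψ => ⟨coOp P.comul φ.toAlgHom ψ.toAlgHom⟩⟩
noncomputable instance : Neg (P.Points R) := ⟨fun φ => ⟨φ.toAlgHom.comp P.coneg⟩⟩

protected theorem add_comm (φ ψ : P.Points R) : φ + ψ = ψ + φ :=
  Points.ext (coOp_comm P.coadd_comm _ _)

protected theorem mul_comm (φ ψ : P.Points R) : φ * ψ = ψ * φ :=
  Points.ext (coOp_comm P.comul_comm _ _)

protected theorem zero_add (φ : P.Points R) : 0 + φ = φ :=
  Points.ext (coOp_unit P.cozero_coadd _)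

protected theorem one_mul (φ : P.Points R) : 1 * φ = φ :=
  Points.ext (coOp_unit P.counit_comul _)

protected theorem mul_add (φ ψ χ : P.Points R) : φ * (ψ + χ) = φ * ψ + φ * χ :=
  Points.ext (coOp_distrib P _ _ _)

protected theorem neg_add (φ : P.Points R) : -φ + φ = 0 :=
  Points.ext (coOp_neg P.coneg_coadd _)

protected theorem zero_mul (φ : P.Points R) : 0 * φ = 0 := by
  have h : φ * 0 + φ * 0 = φ * 0 := by rw [← Points.mul_add, Points.zero_add]
  have h2 := congrArg (fun t => -(φ * 0) + t) h
  have hassoc : -(φ * 0) + (φ * 0 + φ * 0) = -(φ * 0) + φ * 0 + φ * 0 :=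
    (Points.ext (coOp_assoc P.coadd_assoc _ _ _)).symm
  simp only [hassoc, Points.neg_add, Points.zero_add] at h2
  rw [Points.mul_comm, h2]

/-- The ring structure on `Hom_A(S, R)` induced by a biring structure on `S`. -/
noncomputable instance : CommRing (P.Points R) where
  add_assoc _ _ _ := Points.ext (coOp_assoc P.coadd_assoc _ _ _)
  zero_add := Points.zero_add
  add_zero φ := by rw [Points.add_comm, Points.zero_add]
  add_comm := Points.add_comm
  mul_assoc _ _ _ := Points.ext (coOp_assoc P.comul_assoc _ _ _)
  mul_comm := Points.mul_comm
  one_mul := Points.one_mul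
  mul_one φ := by rw [Points.mul_comm, Points.one_mul]
  left_distrib := Points.mul_add
  right_distrib φ ψ χ := by
    rw [Points.mul_comm, Points.mul_add, Points.mul_comm χ φ, Points.mul_comm χ ψ]
  neg_add_cancel := Points.neg_add
  zero_mul := Points.zero_mul
  mul_zero φ := by rw [Points.mul_comm, Points.zero_mul]
  nsmul := nsmulRec
  zsmul := zsmulRec

/-- The structure map `B → Hom_A(S, R)`, which is the composition of the co-`B`-linear structure
`B → Hom_A(S, A)` with the map `Hom_A(S, A) → Hom_A(S, R)`. -/
noncomputable instance : Algebra B (P.Points R) :=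
  RingHom.toAlgebra
    { toFun := fun b => ⟨(Algebra.ofId A R).comp (P.colin b)⟩
      map_zero' := Points.ext (by rw [P.colin_zero]; rfl)
      map_one' := Points.ext (by rw [P.colin_one]; rfl)
      map_add' := fun a b => Points.ext (by rw [P.colin_add, comp_coOp]; rfl)
      map_mul' := fun a b => Points.ext (by rw [P.colin_mul, comp_coOp]; rfl) }

end Points

/-- A homomorphism of `A`-algebras between `A`-`B`-birings is a homomorphism of birings if it
commutes with all the co-operations. -/
structure IsHom {T : Type*} [CommRing T] [Algebra A T] (P : Biring A B S) (Q : Biring A B T)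
    (g : S →ₐ[A] T) : Prop where
  coadd : (Algebra.TensorProduct.map g g).comp P.coadd = Q.coadd.comp g
  cozero : P.cozero = Q.cozero.comp g
  coneg : g.comp P.coneg = Q.coneg.comp g
  comul : (Algebra.TensorProduct.map g g).comp P.comul = Q.comul.comp g
  counit : P.counit = Q.counit.comp g
  colin : ∀ b, P.colin b = (Q.colin b).comp g

/-- The `A`-`A`-biring `A[X]`, which represents the identity functor on `A`-algebras:
`X` is sent to `X ⊗ 1 + 1 ⊗ X` by co-addition, to `X ⊗ X` by co-multiplication, and the
co-`A`-linear structure is `a ↦ (f ↦ f(a))`. -/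
noncomputable def polynomial (A : Type*) [CommRing A] : Biring A A A[X] where
  coadd := aeval (X ⊗ₜ 1 + 1 ⊗ₜ X)
  cozero := aeval 0
  coneg := aeval (-X)
  comul := aeval (X ⊗ₜ X)
  counit := aeval 1
  colin a := aeval a
  coadd_assoc := by
    ext; simp [TensorProduct.add_tmul, TensorProduct.tmul_add, Algebra.TensorProduct.one_def,
      add_assoc]
  coadd_comm := by ext; simp [add_comm]
  cozero_coadd := by ext; simp
  coneg_coadd := by ext; simp [Algebra.ofId_apply]
  comul_assoc := by ext; simp
  comul_comm := by ext; simp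
  counit_comul := by ext; simp
  codistrib := by ext; simp [coOp, mul_add]
  colin_zero := rfl
  colin_one := rfl
  colin_add a b := by ext; simp [coOp]
  colin_mul a b := by ext; simp [coOp]

end Biring

/-! ### Integer-valued polynomials -/

/-- The ring `Int(D) = {f ∈ K[X] : f(D) ⊆ D}` of integer-valued polynomials on `D`, as a
`D`-subalgebra of `K[X]`, where `K` is the field of fractions of `D`. -/
def IntPoly (D K : Type*) [CommRing D] [Field K] [Algebra D K] : Subalgebra D K[X] where
  carrier := {f | ∀ d : D, f.eval (algebraMap D K d) ∈ (algebraMap D K).range}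
  mul_mem' hf hg d := by
    rw [eval_mul]
    exact mul_mem (hf d) (hg d)
  add_mem' hf hg d := by
    rw [eval_add]
    exact add_mem (hf d) (hg d)
  algebraMap_mem' r d := ⟨r, by simp [Polynomial.algebraMap_apply]⟩

namespace IntPoly

variable (D K : Type*) [CommRing D] [Field K] [Algebra D K]

/-- The inclusion `D[X] → Int(D)`. -/
noncomputable def ofPolynomial : D[X] →ₐ[D] IntPoly D K :=
  (Polynomial.mapAlg D K).codRestrict (IntPoly D K) fun f d => ⟨f.eval d, by
    simp [Polynomial.mapAlg_eq_map, aeval_algebraMap_apply]⟩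

variable {D K}

/-- A `D`-`D`-biring structure on `Int(D)` is compatible with the one on `D[X]` if the inclusion
`D[X] → Int(D)` is a homomorphism of birings. -/
def IsCompatible (P : Biring D D (IntPoly D K)) : Prop :=
  (Biring.polynomial D).IsHom P (ofPolynomial D K)

end IntPoly

/-! ### Evaluation at points of the completion -/

namespace IntPoly

open IsDedekindDomain HeightOneSpectrum

variable {D : Type*} [CommRing D] [IsDedekindDomain D] (K : Type*) [Field K] [Algebra D K]
  [IsFractionRing D K] (m : HeightOneSpectrum D)

theorem exists_valued_sub_lt (α : m.adicCompletionIntegers K) {c : D} (hc : c ≠ 0) :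
    ∃ d : D, Valued.v ((α : m.adicCompletion K) - algebraMap D (m.adicCompletion K) d) <
      Valued.v (algebraMap D (m.adicCompletion K) c) := by
  have hα := (mem_adicCompletionIntegers D K m).1 α.2
  have hc0 : algebraMap D K c ≠ 0 := by simpa using hc
  have hvc : m.valuation K (algebraMap D K c) ≠ 0 := (Valuation.ne_zero_iff _).2 hc0
  have hK : ∀ x : K, Valued.v (algebraMap K (m.adicCompletion K) x) = m.valuation K x :=
    fun x => valuedAdicCompletion_eq_valuation' m x
  have hopen : IsOpen {β : m.adicCompletion K | Valued.v ((α : m.adicCompletion K) - β) <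
      Valued.v (algebraMap K (m.adicCompletion K) (algebraMap D K c))} := by
    have := (Valued.isOpen_ball (m.adicCompletion K)
      (Valued.v.restrict (algebraMap K (m.adicCompletion K) (algebraMap D K c)))).preimage
      (continuous_sub_left (α : m.adicCompletion K))
    simpa only [Set.preimage_ofPred_eq, Valuation.restrict_lt_iff] using this
  obtain ⟨x, hx⟩ := (denseRange_algebraMap K m).exists_mem_open hopen
    ⟨(α : m.adicCompletion K), by
      rw [Set.mem_ofPred_eq, sub_self, map_zero, hK]
      exact zero_lt_iff.2 hvc⟩
  rw [Set.mem_ofPred_eq, hK] at hx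
  have hc1 : m.valuation K (algebraMap D K c) ≤ 1 := valuation_le_one m c
  have hx1 : m.valuation K x ≤ 1 := by
    rw [← hK, ← sub_sub_cancel (α : m.adicCompletion K) (algebraMap K _ x)]
    exact (Valuation.map_sub _ _ _).trans (max_le hα (hx.le.trans hc1))
  obtain ⟨d, hd⟩ := exists_valuation_sub_lt_of_integer m hx1 (Units.mk0 _ hvc)
  refine ⟨d, ?_⟩
  rw [IsScalarTower.algebraMap_apply D K (m.adicCompletion K) c,
    IsScalarTower.algebraMap_apply D K (m.adicCompletion K) d, hK (algebraMap D K c),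
    ← sub_add_sub_cancel _ (algebraMap K (m.adicCompletion K) x), ← map_sub]
  refine (Valuation.map_add _ _ _).trans_lt (max_lt hx ?_)
  rw [hK, Valuation.map_sub_swap]
  exact hd

theorem aeval_mem (α : m.adicCompletionIntegers K) (f : IntPoly D K) :
    aeval (α : m.adicCompletion K) (f : K[X]) ∈ m.adicCompletionIntegers K := by
  obtain ⟨c, hc, hp⟩ := IsLocalization.integerNormalization_spec (nonZeroDivisors D) (f : K[X])
  generalize IsLocalization.integerNormalization (nonZeroDivisors D) (f : K[X]) = p at hp
  obtain ⟨d, hd⟩ := exists_valued_sub_lt K m α (nonZeroDivisors.ne_zero hc)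
  have hev : ∀ β : m.adicCompletion K, aeval β p = algebraMap D _ c * aeval β (f : K[X]) := by
    intro β
    rw [← aeval_map_algebraMap K, hp, ← Algebra.smul_def]
    exact map_smul ((aeval β : K[X] →ₐ[K] _).restrictScalars D) c _
  have hfd : aeval (algebraMap D (m.adicCompletion K) d) (f : K[X]) ∈
      m.adicCompletionIntegers K := by
    obtain ⟨r, hr⟩ := f.2 d
    rw [IsScalarTower.algebraMap_apply D K, aeval_algebraMap_apply, coe_aeval_eq_eval, ← hr,
      ← IsScalarTower.algebraMap_apply]
    exact coe_mem_adicCompletionIntegers m r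
  obtain ⟨q, hq⟩ := sub_dvd_eval_sub α (algebraMap D (m.adicCompletionIntegers K) d)
    (p.map (algebraMap D (m.adicCompletionIntegers K)))
  have hq' := congrArg (algebraMap (m.adicCompletionIntegers K) (m.adicCompletion K)) hq
  simp only [eval_map_algebraMap, map_sub, map_mul, ← aeval_algebraMap_apply,
    ← IsScalarTower.algebraMap_apply, hev] at hq'
  have hqv : Valued.v (algebraMap (m.adicCompletionIntegers K) (m.adicCompletion K) q) ≤ 1 :=
    (mem_adicCompletionIntegers D K m).1 q.2
  rw [← mul_sub] at hq'
  have hv := congrArg Valued.v hq'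
  rw [map_mul, map_mul] at hv
  have hlt : Valued.v (algebraMap D (m.adicCompletion K) c) *
      Valued.v (aeval (α : m.adicCompletion K) (f : K[X]) -
        aeval (algebraMap D (m.adicCompletion K) d) (f : K[X])) ≤
      Valued.v (algebraMap D (m.adicCompletion K) c) * 1 := by
    refine hv.le.trans ?_
    exact mul_le_mul' hd.le hqv
  have hle := le_of_mul_le_mul_left hlt (zero_le.trans_lt hd)
  have := add_mem ((mem_adicCompletionIntegers D K m).2 hle) hfd
  rwa [sub_add_cancel] at this

/-- The homomorphism `Int(D) → D̂_m`, `f ↦ f(α)`, for `α ∈ D̂_m`. -/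
noncomputable def evalHom (α : m.adicCompletionIntegers K) :
    IntPoly D K →ₐ[D] m.adicCompletionIntegers K where
  toFun f := ⟨aeval (α : m.adicCompletion K) (f : K[X]), aeval_mem K m α f⟩
  map_zero' := by ext; simp
  map_one' := by ext; simp
  map_add' f g := by ext; simp
  map_mul' f g := by ext; simp
  commutes' d := by
    refine Subtype.ext ?_
    change aeval (α : m.adicCompletion K) (algebraMap D K[X] d) = algebraMap D (m.adicCompletion K) d
    rw [Polynomial.algebraMap_apply, aeval_C, ← IsScalarTower.algebraMap_apply]

/-- The canonical homomorphism `D / m → D̂_m / m D̂_m`. -/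
noncomputable def residueHom :
    D ⧸ m.asIdeal →ₐ[D] m.adicCompletionIntegers K ⧸
      m.asIdeal.map (algebraMap D (m.adicCompletionIntegers K)) :=
  Ideal.quotientMapₐ _ (Algebra.ofId D (m.adicCompletionIntegers K)) Ideal.le_comap_map

theorem residueHom_bijective : Function.Bijective (residueHom K m) := by
  have hlt : ∀ d : D, Valued.v (algebraMap D (m.adicCompletion K) d) < 1 ↔ d ∈ m.asIdeal := by
    intro d
    rw [← valuation_lt_one_iff_mem (K := K), ← valuedAdicCompletion_eq_valuation]
  constructor
  · rw [injective_iff_map_eq_zero]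
    intro x hx
    obtain ⟨d, rfl⟩ := Ideal.Quotient.mk_surjective x
    rw [Ideal.Quotient.eq_zero_iff_mem]
    have hd : algebraMap D (m.adicCompletionIntegers K) d ∈
        m.asIdeal.map (algebraMap D (m.adicCompletionIntegers K)) :=
      Ideal.Quotient.eq_zero_iff_mem.1 hx
    have hnu : ∀ x : m.adicCompletionIntegers K,
        x ∈ IsLocalRing.maximalIdeal (m.adicCompletionIntegers K) ↔
          Valued.v (x : m.adicCompletion K) < 1 := by
      intro x
      rw [IsLocalRing.mem_maximalIdeal, mem_nonunits_iff,
        adicCompletionIntegers.isUnit_iff_valued_eq_one]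
      exact ⟨fun h => lt_of_le_of_ne x.2 h, fun h => h.ne⟩
    have hle : m.asIdeal.map (algebraMap D (m.adicCompletionIntegers K)) ≤
        IsLocalRing.maximalIdeal (m.adicCompletionIntegers K) := by
      rw [Ideal.map_le_iff_le_comap]
      intro c hc
      rw [Ideal.mem_comap, hnu]
      exact (hlt c).2 hc
    have h1 := hle hd
    rw [hnu, algebraMap_adicCompletionIntegers_apply] at h1
    exact (hlt d).1 h1
  · intro x
    obtain ⟨α, rfl⟩ := Ideal.Quotient.mk_surjective x
    obtain ⟨c, hcm, hc⟩ := Submodule.exists_mem_ne_zero_of_ne_bot m.ne_bot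
    obtain ⟨d, hd⟩ := exists_valued_sub_lt K m α hc
    refine ⟨Ideal.Quotient.mk _ d, ?_⟩
    change Ideal.Quotient.mk _ (algebraMap D (m.adicCompletionIntegers K) d) = _
    rw [eq_comm, Ideal.Quotient.eq]
    have hc0 : algebraMap D (m.adicCompletion K) c ≠ 0 := fun h => by
      rw [h, map_zero] at hd
      exact not_lt_zero hd
    have hmem : ((α : m.adicCompletion K) - algebraMap D (m.adicCompletion K) d) /
        algebraMap D (m.adicCompletion K) c ∈ m.adicCompletionIntegers K := by
      rw [mem_adicCompletionIntegers, map_div₀]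
      exact div_le_one_of_le₀ hd.le zero_le
    have heq : α - algebraMap D (m.adicCompletionIntegers K) d =
        algebraMap D (m.adicCompletionIntegers K) c * ⟨_, hmem⟩ :=
      Subtype.ext (mul_div_cancel₀ _ hc0).symm
    rw [heq]
    exact Ideal.mul_mem_right _ _ (Ideal.mem_map_of_mem _ hcm)

/-- The homomorphism `Int(D) → D / m`, `f ↦ f(α) mod m D̂_m`, for `α ∈ D̂_m`, where
`D̂_m / m D̂_m` is identified with `D / m` through the canonical isomorphism. -/
noncomputable def evalMod (α : m.adicCompletionIntegers K) : IntPoly D K →ₐ[D] D ⧸ m.asIdeal :=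
  ((AlgEquiv.ofBijective (residueHom K m) (residueHom_bijective K m)).symm.toAlgHom.comp
    (Ideal.Quotient.mkₐ D
      (m.asIdeal.map (algebraMap D (m.adicCompletionIntegers K))))).comp (evalHom K m α)

end IntPoly

/-- The structure map `D / I → A` of a `D`-algebra `A` with `I A = 0`. -/
noncomputable def quotientToAlgebra {D : Type*} [CommRing D] (I : Ideal D) (A : Type*) [CommRing A]
    [Algebra D A] (h : I.map (algebraMap D A) = ⊥) : D ⧸ I →ₐ[D] A :=
  Ideal.Quotient.liftₐ I (Algebra.ofId D A) fun d hd => by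
    simpa [h] using Ideal.mem_map_of_mem (algebraMap D A) hd

/-! ### Linear forms on submodules of free modules over a domain -/

/-! The biring structure exists because `Int(D) ⊗ Int(D)` contains every polynomial in two variables
over `K` that takes values in `D` on `D × D`. This rests on `exists_smul_eq_of_dvd`: finitely
generated torsion-free modules over a Dedekind domain have dual bases, and such a basis for the span
of the vectors of values splits the polynomial into integer-valued factors. Substitution `f ↦ f(u)`
is then defined for every `u` in the tensor square, which gives co-addition and co-multiplication.
`Int(D)` and its tensor powers are flat, hence torsion-free, so a homomorphism into them is
determined by the image of `X` (`algHom_ext`); this yields the biring axioms, uniqueness, and the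
compatibility of evaluation with the operations.

For the map from the completion to the points over `A`, injectivity means that a nonzero `α` is
separated from `0` modulo `m`. `exists_evalAt_zero_valued_mul` supplies an integer-valued polynomial
that lowers the order of a point of positive order by one; iterating it brings `α` to a unit
(`exists_evalMod_ne_zero`).

Surjectivity is a compactness argument. A polynomial with values in `m` is killed by every
homomorphism `φ` to `A`, and a Fermat-type product shows that finitely many elements of `ker φ` have
values in `m` at a common point of `D`. The completion is compact since `D / m` is finite, so one
`α` serves all of `ker φ`; as `φ` only takes values coming from `D`, it is evaluation at `α`
(`exists_eq_comp_evalMod`). -/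

/-- A linear form on a submodule of `D ^ n` is the restriction of a linear form with coefficients
in the field of fractions. -/
theorem LinearMap.exists_eq_sum_fractionRing {D K : Type*} [CommRing D] [IsDomain D] [Field K]
    [Algebra D K] [IsFractionRing D K] {ι : Type*} [Fintype ι] (E : Submodule D (ι → D))
    (φ : E →ₗ[D] D) :
    ∃ l : ι → K, ∀ x : E, algebraMap D K (φ x) =
      ∑ i, algebraMap D K ((x : ι → D) i) * l i := by
  classical
  let g : (ι → D) →ₗ[D] (ι → K) := LinearMap.pi fun i => Algebra.linearMap D K ∘ₗ LinearMap.proj i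
  have : IsLocalizedModule (nonZeroDivisors D) g := inferInstance
  have hu : ∀ x : nonZeroDivisors D, IsUnit (algebraMap D (Module.End D K) x) := fun x =>
    IsLocalizedModule.map_units (Algebra.linearMap D K) x
  -- After nonzero scalars are inverted, `E` becomes a `K`-subspace of `K ^ n` and `φ` a `K`-linear
  -- form on it, which extends to all of `K ^ n`; `l` lists its values on the standard basis.
  let ψ := IsLocalizedModule.lift (nonZeroDivisors D)
    (E.toLocalized' K (nonZeroDivisors D) g) (Algebra.linearMap D K ∘ₗ φ) hu
  obtain ⟨χ, hχ⟩ := LinearMap.exists_extend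
    (LinearMap.extendScalarsOfIsLocalization (nonZeroDivisors D) K ψ)
  refine ⟨fun i => χ (Pi.single i 1), fun x => ?_⟩
  have h1 : algebraMap D K (φ x) = χ (g x) := by
    have h2 := LinearMap.congr_fun hχ (E.toLocalized' K (nonZeroDivisors D) g x)
    have h3 : ψ (E.toLocalized' K (nonZeroDivisors D) g x) = algebraMap D K (φ x) := by
      simp only [ψ, IsLocalizedModule.lift_apply]
      rfl
    rw [← h3]
    exact h2.symm
  rw [h1, LinearMap.pi_apply_eq_sum_univ χ]
  refine Finset.sum_congr rfl fun i _ => ?_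
  congr 2
  ext k
  simp [Pi.single_apply, eq_comm]

/-- Finite modules without torsion over a Dedekind domain have dual bases. -/
theorem Module.exists_dual_basis {D M : Type*} [CommRing D] [IsDedekindDomain D] [AddCommGroup M]
    [Module D M] [Module.Finite D M] [Module.IsTorsionFree D M] :
    ∃ (n : ℕ) (φ : Fin n → M →ₗ[D] D) (e : Fin n → M), ∀ x, x = ∑ j, φ j x • e j := by
  classical
  -- Torsion-free over a Dedekind domain means flat, and flat with finite presentation means
  -- projective, so `M` is a direct summand of some `D ^ n`.
  have := Module.finitePresentation_of_finite D M
  have := Module.Flat.projective_of_finitePresentation (R := D) (M := M)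
  obtain ⟨n, f, g, -, -, h⟩ := Module.Finite.exists_comp_eq_id_of_projective D M
  refine ⟨n, fun j => LinearMap.proj j ∘ₗ g, fun j => f (Pi.single j 1), fun x => ?_⟩
  conv_lhs => rw [← LinearMap.id_apply (R := D) x, ← h, LinearMap.comp_apply,
    LinearMap.pi_apply_eq_sum_univ f]
  refine Finset.sum_congr rfl fun i _ => ?_
  congr 2
  ext k
  simp [Pi.single_apply, eq_comm]

namespace IntPoly

variable {D K : Type*} [CommRing D] [Field K] [Algebra D K]

/-! ### Evaluation, composition and denominators in one variable -/

section Basic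

theorem ofPolynomial_coe (p : D[X]) : (ofPolynomial D K p : K[X]) = p.map (algebraMap D K) :=
  Polynomial.mapAlg_eq_map K p

variable [IsFractionRing D K]

variable (K) in
/-- The homomorphism `Int(D) → D`, `f ↦ f(d)`, for `d ∈ D`. -/
noncomputable def evalAt (d : D) : IntPoly D K →ₐ[D] D :=
  (AlgEquiv.ofInjective (Algebra.ofId D K)
    (IsFractionRing.injective D K)).symm.toAlgHom.comp
    ((((aeval (algebraMap D K d) : K[X] →ₐ[K] K).restrictScalars D).comp
      (IntPoly D K).val).codRestrict (Algebra.ofId D K).range fun f => f.2 d)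

theorem algebraMap_evalAt (d : D) (f : IntPoly D K) :
    algebraMap D K (evalAt K d f) = (f : K[X]).eval (algebraMap D K d) := by
  exact congrArg Subtype.val ((AlgEquiv.ofInjective (Algebra.ofId D K)
    (IsFractionRing.injective D K)).apply_symm_apply
      ⟨(f : K[X]).eval (algebraMap D K d), f.2 d⟩)

@[simp]
theorem evalAt_ofPolynomial (d : D) (p : D[X]) : evalAt K d (ofPolynomial D K p) = p.eval d := by
  apply IsFractionRing.injective D K
  simp [algebraMap_evalAt, ofPolynomial_coe, aeval_algebraMap_apply, coe_aeval_eq_eval]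

theorem exists_smul_eq_of_dvd_evalAt {c : D} (hc : c ≠ 0) (f : IntPoly D K)
    (h : ∀ d, c ∣ evalAt K d f) : ∃ g : IntPoly D K, c • g = f := by
  have hc0 : algebraMap D K c ≠ 0 :=
    (map_ne_zero_iff _ (IsFractionRing.injective D K)).2 hc
  refine ⟨⟨C (algebraMap D K c)⁻¹ * (f : K[X]), fun d => ?_⟩, Subtype.ext ?_⟩
  · obtain ⟨r, hr⟩ := h d
    refine ⟨r, ?_⟩
    rw [eval_mul, eval_C, ← algebraMap_evalAt, hr, map_mul, inv_mul_cancel_left₀ hc0]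
  · change c • (C (algebraMap D K c)⁻¹ * (f : K[X])) = f
    rw [Algebra.smul_def, Polynomial.algebraMap_apply, ← mul_assoc, ← C_mul, mul_inv_cancel₀ hc0,
      C_1, one_mul]

/-- The composition `f ↦ f ∘ g` with an integer-valued polynomial `g`. -/
noncomputable def compRight (g : IntPoly D K) : IntPoly D K →ₐ[D] IntPoly D K :=
  (((aeval (g : K[X]) : K[X] →ₐ[K] K[X]).restrictScalars D).comp (IntPoly D K).val).codRestrict
    (IntPoly D K) fun f d => ⟨evalAt K (evalAt K d g) f, by
      simp [algebraMap_evalAt, ← comp_eq_aeval, eval_comp]⟩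

theorem compRight_coe (g f : IntPoly D K) :
    (compRight g f : K[X]) = (f : K[X]).comp (g : K[X]) := by
  rw [comp_eq_aeval]
  rfl

@[simp]
theorem compRight_X (g : IntPoly D K) : compRight g (ofPolynomial D K X) = g :=
  Subtype.ext (by simp [compRight_coe, ofPolynomial_coe])

variable [IsDomain D]

theorem exists_smul_eq_ofPolynomial (f : IntPoly D K) :
    ∃ c : D, c ≠ 0 ∧ ∃ p : D[X], c • f = ofPolynomial D K p := by
  obtain ⟨c, hc, hp⟩ := IsLocalization.integerNormalization_spec (nonZeroDivisors D) (f : K[X])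
  exact ⟨c, nonZeroDivisors.ne_zero hc, _, Subtype.ext (by rw [ofPolynomial_coe, hp]; rfl)⟩

/-- Homomorphisms from `Int(D)` to an algebra without torsion are determined by the image
of `X`. -/
theorem algHom_ext {T : Type*} [CommRing T] [Algebra D T] [Module.IsTorsionFree D T]
    {φ ψ : IntPoly D K →ₐ[D] T} (h : φ (ofPolynomial D K X) = ψ (ofPolynomial D K X)) : φ = ψ := by
  have h1 : φ.comp (ofPolynomial D K) = ψ.comp (ofPolynomial D K) := Polynomial.algHom_ext h
  ext f
  obtain ⟨c, hc, p, hp⟩ := exists_smul_eq_ofPolynomial f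
  refine smul_right_injective T hc ?_
  simp only [← map_smul, hp]
  exact DFunLike.congr_fun h1 p

end Basic

/-! ### Integer-valued polynomials in two variables -/

section Tensor

variable [IsFractionRing D K]

variable (K) in
/-- The evaluation `∑ fᵢ ⊗ gᵢ ↦ ∑ fᵢ(a) gᵢ(b)` on `Int(D) ⊗ Int(D)`. -/
noncomputable def evalAt₂ (a b : D) : IntPoly D K ⊗[D] IntPoly D K →ₐ[D] D :=
  Algebra.TensorProduct.productMap (evalAt K a) (evalAt K b)

@[simp]
theorem evalAt₂_tmul (a b : D) (f g : IntPoly D K) :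
    evalAt₂ K a b (f ⊗ₜ g) = evalAt K a f * evalAt K b g := by
  simp [evalAt₂]

variable (D K) in
/-- The homomorphism `D[X] ⊗ D[X] → Int(D) ⊗ Int(D)`. -/
noncomputable def ofPolynomial₂ : D[X] ⊗[D] D[X] →ₐ[D] IntPoly D K ⊗[D] IntPoly D K :=
  Algebra.TensorProduct.map (ofPolynomial D K) (ofPolynomial D K)

theorem evalAt₂_ofPolynomial₂ (a b : D) (w : D[X] ⊗[D] D[X]) :
    evalAt₂ K a b (ofPolynomial₂ D K w) =
      Algebra.TensorProduct.productMap (aeval a : D[X] →ₐ[D] D) (aeval b) w := by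
  rw [← AlgHom.comp_apply]
  congr 1
  ext <;> simp [ofPolynomial₂]

variable [IsDomain D]

theorem exists_smul_eq_ofPolynomial₂ (t : IntPoly D K ⊗[D] IntPoly D K) :
    ∃ c : D, c ≠ 0 ∧ ∃ w, c • t = ofPolynomial₂ D K w := by
  induction t using TensorProduct.induction_on with
  | zero => exact ⟨1, one_ne_zero, 0, by simp⟩
  | tmul f g =>
    obtain ⟨c, hc, p, hp⟩ := exists_smul_eq_ofPolynomial f
    obtain ⟨d, hd, q, hq⟩ := exists_smul_eq_ofPolynomial g
    exact ⟨c * d, mul_ne_zero hc hd, p ⊗ₜ q, by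
      rw [← TensorProduct.smul_tmul_smul, hp, hq]
      simp [ofPolynomial₂]⟩
  | add s t hs ht =>
    obtain ⟨c, hc, p, hp⟩ := hs
    obtain ⟨d, hd, q, hq⟩ := ht
    exact ⟨c * d, mul_ne_zero hc hd, d • p + c • q, by
      rw [smul_add, mul_smul, mul_smul, smul_comm c d s, hp, hq, map_add, map_smul, map_smul]⟩

/-- Viewed as a polynomial in one variable over the domain `D[X]`, `w` has every constant `C b` as a
root, and these are infinitely many. -/
theorem _root_.Polynomial.tensor_eq_zero_of_eval [Infinite D] {w : D[X] ⊗[D] D[X]}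
    (h : ∀ a b, Algebra.TensorProduct.productMap (aeval a : D[X] →ₐ[D] D) (aeval b) w = 0) :
    w = 0 := by
  obtain ⟨P, rfl⟩ := (polyEquivTensor D D[X]).surjective w
  rw [map_eq_zero_iff _ (polyEquivTensor D D[X]).injective]
  have hP : ∀ a b, Algebra.TensorProduct.productMap (aeval a : D[X] →ₐ[D] D) (aeval b)
      (polyEquivTensor D D[X] P) = (P.eval (C b)).eval a := by
    intro a b
    clear h
    induction P using Polynomial.induction_on' with
    | add p q hp hq => simp only [map_add, eval_add, hp, hq]
    | monomial n r => simp [polyEquivTensor_apply, eval₂_monomial, coe_aeval_eq_eval]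
  simp only [hP] at h
  refine Polynomial.eq_zero_of_infinite_isRoot P
    ((Set.infinite_range_of_injective (C_injective (R := D))).mono ?_)
  rintro _ ⟨b, rfl⟩
  exact Polynomial.funext fun a => by simpa using h a b

end Tensor

/-! ### Divisibility of values and substitution over a Dedekind domain -/

section Dedekind

variable [IsDedekindDomain D] [IsFractionRing D K]

/-- A nonzero multiple of the difference comes from `D[X] ⊗ D[X]` and vanishes on `D × D`, hence is
zero; the tensor square is torsion-free. -/
theorem ext_evalAt₂ [Infinite D] {s t : IntPoly D K ⊗[D] IntPoly D K}
    (h : ∀ a b, evalAt₂ K a b s = evalAt₂ K a b t) : s = t := by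
  obtain ⟨c, hc, w, hw⟩ := exists_smul_eq_ofPolynomial₂ (s - t)
  have : w = 0 := Polynomial.tensor_eq_zero_of_eval fun a b => by
    rw [← evalAt₂_ofPolynomial₂ (K := K), ← hw, map_smul, map_sub, h, sub_self, smul_zero]
  rw [this, map_zero] at hw
  exact sub_eq_zero.1 ((smul_eq_zero_iff_right hc).1 hw)

/-- A polynomial in two variables all whose values are divisible by `c` is a multiple of `c` in
`Int(D) ⊗ Int(D)`. -/
theorem exists_smul_eq_of_dvd [Infinite D] {c : D} (hc : c ≠ 0) (w : D[X] ⊗[D] D[X])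
    (h : ∀ a b, c ∣ evalAt₂ K a b (ofPolynomial₂ D K w)) :
    ∃ t, c • t = ofPolynomial₂ D K w := by
  obtain ⟨n, p, q, rfl⟩ : ∃ (n : ℕ) (p q : Fin n → D[X]), w = ∑ i, p i ⊗ₜ[D] q i := by
    obtain ⟨S, hS⟩ := TensorProduct.exists_finset w
    refine ⟨S.card, fun i => (S.equivFin.symm i).1.1, fun i => (S.equivFin.symm i).1.2, ?_⟩
    rw [hS, ← Finset.sum_coe_sort S (fun i => i.1 ⊗ₜ[D] i.2)]
    exact (Equiv.sum_comp S.equivFin.symm (fun i => i.1.1 ⊗ₜ[D] i.1.2)).symm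
  have hval : ∀ a b, evalAt₂ K a b (ofPolynomial₂ D K (∑ i, p i ⊗ₜ[D] q i)) =
      ∑ i, (p i).eval a * (q i).eval b := by
    intro a b
    simp [evalAt₂_ofPolynomial₂, coe_aeval_eq_eval]
  simp only [hval] at h
  -- With a dual basis `φ j`, `e j` of the span `E` of the vectors `v a`, one has `w(a, b) = ∑ j, φ
  -- j (v a) * ∑ i, (e j) i * q i (b)`. The first factor is integer-valued in `a`. The second is
  -- divisible by `c`, since this holds for each `v a` in place of `e j` and these span `E`.
  let v : D → Fin n → D := fun a i => (p i).eval a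
  let E : Submodule D (Fin n → D) := Submodule.span D (Set.range v)
  have hv : ∀ a, v a ∈ E := fun a => Submodule.subset_span ⟨a, rfl⟩
  obtain ⟨k, φ, e, he⟩ := Module.exists_dual_basis (D := D) (M := E)
  have hf : ∀ j, ∃ f : IntPoly D K, ∀ a, evalAt K a f = φ j ⟨v a, hv a⟩ := by
    intro j
    -- Coefficients in `K` are what makes `a ↦ φ j (v a)` a polynomial function: it is given by `∑
    -- i, l i * p i`.
    obtain ⟨l, hl⟩ := LinearMap.exists_eq_sum_fractionRing (K := K) E (φ j)
    have hev : ∀ a, (∑ i, (p i).map (algebraMap D K) * C (l i)).eval (algebraMap D K a) =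
        algebraMap D K (φ j ⟨v a, hv a⟩) := by
      intro a
      rw [hl]
      simp [eval_finsetSum, v, aeval_algebraMap_apply, coe_aeval_eq_eval]
    refine ⟨⟨∑ i, (p i).map (algebraMap D K) * C (l i), fun a => ⟨_, (hev a).symm⟩⟩, fun a => ?_⟩
    apply IsFractionRing.injective D K
    rw [algebraMap_evalAt, ← hev]
  choose f hf using hf
  have hdvd : ∀ x ∈ E, ∀ b, c ∣ ∑ i, x i * (q i).eval b := by
    intro x hx b
    induction hx using Submodule.span_induction with
    | mem x hx =>
      obtain ⟨a, rfl⟩ := hx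
      exact h a b
    | zero => simp
    | add x y _ _ hx hy => simpa [add_mul, Finset.sum_add_distrib] using dvd_add hx hy
    | smul r x _ hx => simpa [mul_assoc, ← Finset.mul_sum] using hx.mul_left r
  have hg : ∀ j, ∃ g : IntPoly D K, ∀ b,
      c * evalAt K b g = ∑ i, (e j : Fin n → D) i * (q i).eval b := by
    intro j
    have hev : ∀ b, evalAt K b (∑ i, (e j : Fin n → D) i • ofPolynomial D K (q i)) =
        ∑ i, (e j : Fin n → D) i * (q i).eval b := fun b => by simp
    obtain ⟨g, hg⟩ := exists_smul_eq_of_dvd_evalAt hc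
      (∑ i, (e j : Fin n → D) i • ofPolynomial D K (q i))
      fun b => by rw [hev]; exact hdvd _ (e j).2 b
    exact ⟨g, fun b => by rw [← hev, ← hg, map_smul, smul_eq_mul]⟩
  choose g hg using hg
  refine ⟨∑ j, f j ⊗ₜ g j, ext_evalAt₂ fun a b => ?_⟩
  rw [hval, map_smul, map_sum, smul_eq_mul, Finset.mul_sum]
  have h1 : ∀ i, (p i).eval a = ∑ j, φ j ⟨v a, hv a⟩ * (e j : Fin n → D) i := by
    intro i
    have h2 := congrArg (fun x : E => (x : Fin n → D) i) (he ⟨v a, hv a⟩)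
    simpa [v] using h2
  simp only [h1, Finset.sum_mul]
  rw [Finset.sum_comm]
  refine Finset.sum_congr rfl fun j _ => ?_
  rw [evalAt₂_tmul, mul_left_comm, hg, hf, Finset.mul_sum]
  simp only [mul_assoc]

/-- Clearing the denominators `c` of `f` and `d` of `(c f)(u)` leaves a polynomial `w` with values
`d c f(u(a, b))`, so `w` can be divided by `d * c` in the tensor square. -/
theorem exists_evalAt₂_eq [Infinite D] (u : IntPoly D K ⊗[D] IntPoly D K) (f : IntPoly D K) :
    ∃ t, ∀ a b, evalAt₂ K a b t = evalAt K (evalAt₂ K a b u) f := by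
  obtain ⟨c, hc, p, hp⟩ := exists_smul_eq_ofPolynomial f
  obtain ⟨d, hd, w, hw⟩ := exists_smul_eq_ofPolynomial₂ (aeval u p)
  have hcf : ∀ x, c * evalAt K x f = p.eval x := fun x => by
    rw [← smul_eq_mul, ← map_smul, hp, evalAt_ofPolynomial]
  have hval : ∀ a b, evalAt₂ K a b (ofPolynomial₂ D K w) =
      d * c * evalAt K (evalAt₂ K a b u) f := by
    intro a b
    rw [← hw, map_smul, ← aeval_algHom_apply, coe_aeval_eq_eval, smul_eq_mul, mul_assoc, hcf]
  obtain ⟨t, ht⟩ := exists_smul_eq_of_dvd (K := K) (mul_ne_zero hd hc) w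
    fun a b => ⟨_, hval a b⟩
  refine ⟨t, fun a b => mul_left_cancel₀ (mul_ne_zero hd hc) ?_⟩
  rw [← hval, ← ht, map_smul, smul_eq_mul]

/-- The substitution `f ↦ f(u)`, for `u ∈ Int(D) ⊗ Int(D)`. -/
theorem exists_algHom_X_eq [Infinite D] (u : IntPoly D K ⊗[D] IntPoly D K) :
    ∃ φ : IntPoly D K →ₐ[D] IntPoly D K ⊗[D] IntPoly D K, φ (ofPolynomial D K X) = u := by
  choose φ hφ using exists_evalAt₂_eq (K := K) u
  -- Elements of the tensor square are determined by their values, so all the homomorphism laws are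
  -- checked pointwise.
  refine ⟨AlgHom.mk (RingHom.mk (MonoidHom.mk (OneHom.mk φ ?_) ?_) ?_ ?_) ?_, ?_⟩
  · exact ext_evalAt₂ fun a b => by simp only [hφ, map_one]
  · exact fun f g => ext_evalAt₂ fun a b => by simp only [hφ, map_mul]
  · exact ext_evalAt₂ fun a b => by simp only [hφ, map_zero]
  · exact fun f g => ext_evalAt₂ fun a b => by simp only [hφ, map_add]
  · exact fun r => ext_evalAt₂ fun a b => (hφ _ a b).trans (by
      rw [AlgHom.commutes, AlgHom.commutes])
  · exact ext_evalAt₂ fun a b => (hφ _ a b).trans (by rw [evalAt_ofPolynomial, eval_X])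

end Dedekind

end IntPoly

/-! ### The biring structure -/

/-- A biring structure on an algebra `S` with an element `x` such that algebra homomorphisms from
`S` to `A` and to tensor powers of `S` are determined by the image of `x`. -/
noncomputable def Biring.ofGenerator {A S : Type*} [CommRing A] [CommRing S] [Algebra A S] (x : S)
    (h₀ : ∀ φ ψ : S →ₐ[A] A, φ x = ψ x → φ = ψ)
    (h₁ : ∀ φ ψ : S →ₐ[A] S, φ x = ψ x → φ = ψ)
    (h₂ : ∀ φ ψ : S →ₐ[A] S ⊗[A] S, φ x = ψ x → φ = ψ)
    (h₃ : ∀ φ ψ : S →ₐ[A] S ⊗[A] (S ⊗[A] S), φ x = ψ x → φ = ψ)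
    (coadd comul : S →ₐ[A] S ⊗[A] S) (coneg : S →ₐ[A] S) (colin : A → S →ₐ[A] A)
    (hadd : coadd x = x ⊗ₜ 1 + 1 ⊗ₜ x) (hmul : comul x = x ⊗ₜ x) (hneg : coneg x = -x)
    (hlin : ∀ a, colin a x = a) : Biring A A S where
  coadd := coadd
  cozero := colin 0
  coneg := coneg
  comul := comul
  counit := colin 1
  colin := colin
  coadd_assoc := h₃ _ _ (by
    simp [hadd, TensorProduct.add_tmul, TensorProduct.tmul_add, Algebra.TensorProduct.one_def,
      add_assoc])
  coadd_comm := h₂ _ _ (by simp [hadd, add_comm])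
  cozero_coadd := h₁ _ _ (by simp [hadd, hlin])
  coneg_coadd := h₁ _ _ (by simp [hadd, hneg, hlin, Algebra.ofId_apply])
  comul_assoc := h₃ _ _ (by simp [hmul])
  comul_comm := h₂ _ _ (by simp [hmul])
  counit_comul := h₁ _ _ (by simp [hmul, hlin])
  codistrib := h₃ _ _ (by simp [coOp, hadd, hmul, mul_add])
  colin_zero := rfl
  colin_one := rfl
  colin_add a b := h₀ _ _ (by simp [coOp, hadd, hlin])
  colin_mul a b := h₀ _ _ (by simp [coOp, hmul, hlin])

namespace IntPoly

variable {D K : Type*} [CommRing D] [Field K] [Algebra D K]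

namespace IsCompatible

variable {P : Biring D D (IntPoly D K)}

theorem coadd_X (hP : IsCompatible P) : P.coadd (ofPolynomial D K X) =
    ofPolynomial D K X ⊗ₜ 1 + 1 ⊗ₜ ofPolynomial D K X := by
  simpa [Biring.polynomial] using (DFunLike.congr_fun hP.coadd X).symm

theorem comul_X (hP : IsCompatible P) : P.comul (ofPolynomial D K X) =
    ofPolynomial D K X ⊗ₜ ofPolynomial D K X := by
  simpa [Biring.polynomial] using (DFunLike.congr_fun hP.comul X).symm

theorem coneg_X (hP : IsCompatible P) : P.coneg (ofPolynomial D K X) = -ofPolynomial D K X := by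
  simpa [Biring.polynomial] using (DFunLike.congr_fun hP.coneg X).symm

theorem cozero_X (hP : IsCompatible P) : P.cozero (ofPolynomial D K X) = 0 := by
  simpa [Biring.polynomial] using (DFunLike.congr_fun hP.cozero X).symm

theorem counit_X (hP : IsCompatible P) : P.counit (ofPolynomial D K X) = 1 := by
  simpa [Biring.polynomial] using (DFunLike.congr_fun hP.counit X).symm

theorem colin_X (hP : IsCompatible P) (a : D) : P.colin a (ofPolynomial D K X) = a := by
  simpa [Biring.polynomial] using (DFunLike.congr_fun (hP.colin a) X).symm

end IsCompatible

variable [IsDedekindDomain D] [IsFractionRing D K]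

instance : Module.IsTorsionFree D (IntPoly D K) := inferInstance

instance : Module.Flat D (IntPoly D K) := inferInstance

theorem exists_isCompatible [Infinite D] : ∃ P : Biring D D (IntPoly D K), IsCompatible P := by
  have : Module.Flat D (IntPoly D K ⊗[D] IntPoly D K) := inferInstance
  have : Module.Flat D (IntPoly D K ⊗[D] (IntPoly D K ⊗[D] IntPoly D K)) := inferInstance
  have : Module.IsTorsionFree D (IntPoly D K ⊗[D] (IntPoly D K ⊗[D] IntPoly D K)) :=
    Module.Flat.isTorsionFree
  obtain ⟨coadd, hadd⟩ := exists_algHom_X_eq (K := K)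
    (ofPolynomial D K X ⊗ₜ 1 + 1 ⊗ₜ ofPolynomial D K X)
  obtain ⟨comul, hmul⟩ := exists_algHom_X_eq (K := K)
    (ofPolynomial D K X ⊗ₜ ofPolynomial D K X)
  have hneg : compRight (-ofPolynomial D K X) (ofPolynomial D K X) = -ofPolynomial D K X :=
    compRight_X _
  have hlin : ∀ a, evalAt K a (ofPolynomial D K X) = a := fun a => by simp
  refine ⟨Biring.ofGenerator (ofPolynomial D K X) (fun _ _ => algHom_ext) (fun _ _ => algHom_ext)
    (fun _ _ => algHom_ext) (fun _ _ => algHom_ext) coadd comul _ _ hadd hmul hneg hlin,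
    ⟨?_, ?_, ?_, ?_, ?_, ?_⟩⟩
  · exact Polynomial.algHom_ext (by simp [Biring.ofGenerator, Biring.polynomial, hadd])
  · exact Polynomial.algHom_ext (by simp [Biring.ofGenerator, Biring.polynomial])
  · exact Polynomial.algHom_ext (by simp [Biring.ofGenerator, Biring.polynomial])
  · exact Polynomial.algHom_ext (by simp [Biring.ofGenerator, Biring.polynomial, hmul])
  · exact Polynomial.algHom_ext (by simp [Biring.ofGenerator, Biring.polynomial])
  · exact fun b => Polynomial.algHom_ext (by simp [Biring.ofGenerator, Biring.polynomial])

theorem IsCompatible.eq {P Q : Biring D D (IntPoly D K)} (hP : IsCompatible P)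
    (hQ : IsCompatible Q) : P = Q :=
  Biring.ext (algHom_ext (by rw [hP.coadd_X, hQ.coadd_X]))
    (algHom_ext (by rw [hP.cozero_X, hQ.cozero_X])) (algHom_ext (by rw [hP.coneg_X, hQ.coneg_X]))
    (algHom_ext (by rw [hP.comul_X, hQ.comul_X])) (algHom_ext (by rw [hP.counit_X, hQ.counit_X]))
    (funext fun a => algHom_ext (by rw [hP.colin_X, hQ.colin_X]))

end IntPoly

/-! ### Uniformizers and the topology of the completion -/

namespace IsDedekindDomain.HeightOneSpectrum

variable {D : Type*} [CommRing D] [IsDedekindDomain D]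

/-- A finite domain is a field, which has no nonzero proper ideal. -/
theorem infinite (m : HeightOneSpectrum D) : Infinite D := by
  by_contra h
  rw [not_infinite_iff_finite] at h
  let _ := (Finite.isField_of_domain D).toField
  exact m.isPrime.ne_top ((Ideal.eq_bot_or_top m.asIdeal).resolve_left m.ne_bot)

/-- A uniformizer `π` at `m`, and an element `e` outside of `m` such that `e m` is contained in
the ideal generated by `π`. -/
theorem exists_uniformizer_mul_dvd (m : HeightOneSpectrum D) :
    ∃ π e : D, m.intValuation π = WithZero.exp (-1 : ℤ) ∧ e ∉ m.asIdeal ∧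
      ∀ x ∈ m.asIdeal, π ∣ e * x := by
  obtain ⟨π, hπ⟩ := m.intValuation_exists_uniformizer
  have hmem : π ∈ m.asIdeal := by
    rw [← intValuation_lt_one_iff_mem, hπ, ← WithZero.exp_zero, WithZero.exp_lt_exp]
    norm_num
  -- Write `(π) = m I`. As `π` is not in `m ^ 2`, `I` is not contained in `m`, and any `e` in `I`
  -- outside `m` satisfies `e m ⊆ I m = (π)`.
  obtain ⟨I, hI⟩ := Ideal.dvd_iff_le.2 ((Ideal.span_singleton_le_iff_mem _).2 hmem)
  have hle : ¬ I ≤ m.asIdeal := by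
    intro h
    have h2 : π ∈ m.asIdeal ^ 2 := by
      rw [pow_two]
      refine Ideal.mul_mono_right h ?_
      rw [← hI]
      exact Ideal.mem_span_singleton_self π
    rw [← intValuation_le_pow_iff_mem, hπ, WithZero.exp_le_exp] at h2
    norm_num at h2
  obtain ⟨e, he, hem⟩ := SetLike.not_le_iff_exists.1 hle
  refine ⟨π, e, hπ, hem, fun x hx => ?_⟩
  rw [← Ideal.mem_span_singleton, hI, mul_comm e]
  exact Ideal.mul_mem_mul hx he

variable (K : Type*) [Field K] [Algebra D K] [IsFractionRing D K] (m : HeightOneSpectrum D)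

theorem valued_algebraMap_lt_one_iff (d : D) :
    Valued.v (algebraMap D (m.adicCompletion K) d) < 1 ↔ d ∈ m.asIdeal := by
  rw [← valuation_lt_one_iff_mem (K := K), ← valuedAdicCompletion_eq_valuation]

theorem valued_algebraMap_eq_one_iff (d : D) :
    Valued.v (algebraMap D (m.adicCompletion K) d) = 1 ↔ d ∉ m.asIdeal := by
  rw [← valuation_eq_one_iff_notMem (K := K), ← valuedAdicCompletion_eq_valuation]

theorem valued_algebraMap_eq_intValuation (d : D) :
    Valued.v (algebraMap D (m.adicCompletion K) d) = m.intValuation d := by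
  rw [← valuation_of_algebraMap (K := K), ← valuedAdicCompletion_eq_valuation]

/-- Values are discrete: valuation below `1` is at most that of a uniformizer `π ∈ m`, so such an
`α` is an integral multiple of `π`. -/
theorem mem_map_asIdeal_iff (α : m.adicCompletionIntegers K) :
    α ∈ m.asIdeal.map (algebraMap D (m.adicCompletionIntegers K)) ↔
      Valued.v (α : m.adicCompletion K) < 1 := by
  constructor
  · intro h
    have hnu : ∀ x : m.adicCompletionIntegers K,
        x ∈ IsLocalRing.maximalIdeal (m.adicCompletionIntegers K) ↔
          Valued.v (x : m.adicCompletion K) < 1 := by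
      intro x
      rw [IsLocalRing.mem_maximalIdeal, mem_nonunits_iff,
        adicCompletionIntegers.isUnit_iff_valued_eq_one]
      exact ⟨fun h => lt_of_le_of_ne x.2 h, fun h => h.ne⟩
    rw [← hnu]
    refine (Ideal.map_le_iff_le_comap.2 fun c hc => ?_) h
    rw [Ideal.mem_comap, hnu]
    exact (valued_algebraMap_lt_one_iff K m c).2 hc
  · intro h
    obtain ⟨π, e, hπ, -, -⟩ := m.exists_uniformizer_mul_dvd
    have hv := valued_algebraMap_eq_intValuation K m π
    rw [hπ] at hv
    have hπ0 : algebraMap D (m.adicCompletion K) π ≠ 0 := fun h0 => by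
      rw [h0, map_zero] at hv
      exact WithZero.exp_ne_zero hv.symm
    have hle : Valued.v (α : m.adicCompletion K) ≤ WithZero.exp (-1 : ℤ) := by
      by_cases h0 : Valued.v (α : m.adicCompletion K) = 0
      · rw [h0]
        exact zero_le
      · rw [← WithZero.exp_log h0, ← WithZero.exp_zero, WithZero.exp_lt_exp] at h
        rw [← WithZero.exp_log h0, WithZero.exp_le_exp]
        omega
    have hmem : (α : m.adicCompletion K) / algebraMap D (m.adicCompletion K) π ∈
        m.adicCompletionIntegers K := by
      rw [mem_adicCompletionIntegers, map_div₀, hv]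
      exact div_le_one_of_le₀ hle zero_le
    have heq : α = algebraMap D (m.adicCompletionIntegers K) π * ⟨_, hmem⟩ :=
      Subtype.ext (mul_div_cancel₀ _ hπ0).symm
    rw [heq]
    refine Ideal.mul_mem_right _ _ (Ideal.mem_map_of_mem _ ?_)
    rw [← valued_algebraMap_lt_one_iff K, hv, ← WithZero.exp_zero, WithZero.exp_lt_exp]
    norm_num

/-- The ring is closed in a complete field, and representatives of the finite ring `D / m ^ n`
approximate all its points to within `exp (-n)`, so it is totally bounded. -/
theorem isCompact_adicCompletionIntegers [Finite (D ⧸ m.asIdeal)] :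
    IsCompact (m.adicCompletionIntegers K : Set (m.adicCompletion K)) := by
  have hclosed : IsClosed (m.adicCompletionIntegers K : Set (m.adicCompletion K)) :=
    Valued.isClosed_valuationSubring _
  refine isCompact_iff_totallyBounded_isComplete.2 ⟨?_, hclosed.isComplete⟩
  rw [(Valued.hasBasis_uniformity (m.adicCompletion K) _).totallyBounded_iff]
  intro γ _
  set δ := MonoidWithZeroHom.ValueGroup₀.embedding
    (f := .ofClass (Valued.v : Valuation (m.adicCompletion K) _)) γ.1 with hδ
  have hδ0 : δ ≠ 0 := by
    rw [hδ, Ne, map_eq_zero_iff _ MonoidWithZeroHom.ValueGroup₀.embedding_injective]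
    exact γ.ne_zero
  obtain ⟨n, hn⟩ : ∃ n : ℕ, WithZero.exp (-(n : ℤ)) < δ := by
    -- The extra `1` makes `-n < log δ` strict.
    refine ⟨(1 - WithZero.log δ).toNat, ?_⟩
    rw [← WithZero.exp_log hδ0, WithZero.exp_lt_exp, WithZero.log_exp]
    omega
  have hfin : Finite (D ⧸ m.asIdeal ^ n) :=
    Ideal.finite_quotient_pow (IsNoetherian.noetherian m.asIdeal) n
  obtain ⟨π, e, hπ, -, -⟩ := m.exists_uniformizer_mul_dvd
  have hπ0 : π ^ n ≠ 0 := pow_ne_zero n fun h => by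
    rw [h, map_zero] at hπ
    exact WithZero.exp_ne_zero hπ.symm
  refine ⟨Set.range fun r : D ⧸ m.asIdeal ^ n =>
    algebraMap D (m.adicCompletion K) (Quotient.out r), Set.finite_range _, fun x hx => ?_⟩
  obtain ⟨d, hd⟩ := IntPoly.exists_valued_sub_lt K m ⟨x, hx⟩ hπ0
  rw [valued_algebraMap_eq_intValuation, map_pow, hπ, ← WithZero.exp_nsmul, nsmul_eq_mul,
    mul_neg_one] at hd
  rw [Set.mem_iUnion₂]
  refine ⟨_, ⟨Ideal.Quotient.mk _ d, rfl⟩, ?_⟩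
  change Valued.v.restrict _ < γ.1
  rw [Valuation.restrict_lt_iff_lt_embedding, ← hδ, Valuation.map_sub_swap,
    ← sub_add_sub_cancel x (algebraMap D (m.adicCompletion K) d), ← map_sub]
  refine (Valuation.map_add _ _ _).trans_lt (max_lt (hd.trans hn) (lt_of_le_of_lt ?_ hn))
  rw [valued_algebraMap_eq_intValuation, intValuation_le_pow_iff_mem, ← Ideal.Quotient.eq]
  exact (Ideal.Quotient.mk_out _).symm

end IsDedekindDomain.HeightOneSpectrum

/-! ### Values of integer-valued polynomials on the completion -/

namespace IntPoly

open IsDedekindDomain HeightOneSpectrum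

variable {D : Type*} [CommRing D] [IsDedekindDomain D] (K : Type*) [Field K] [Algebra D K]
  [IsFractionRing D K] (m : HeightOneSpectrum D)

@[simp]
theorem evalHom_X (α : m.adicCompletionIntegers K) :
    evalHom K m α (ofPolynomial D K X) = α :=
  Subtype.ext (by simp [evalHom, ofPolynomial_coe])

theorem evalHom_ofPolynomial (α : m.adicCompletionIntegers K) (p : D[X]) :
    evalHom K m α (ofPolynomial D K p) = aeval α p := by
  have : (evalHom K m α).comp (ofPolynomial D K) = aeval α := Polynomial.algHom_ext (by simp)
  exact DFunLike.congr_fun this p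

theorem evalHom_algebraMap (d : D) :
    evalHom K m (algebraMap D _ d) = (Algebra.ofId D _).comp (evalAt K d) :=
  algHom_ext (by simp [Algebra.ofId_apply])

theorem evalHom_compRight (α : m.adicCompletionIntegers K) (g : IntPoly D K) :
    (evalHom K m α).comp (compRight g) = evalHom K m (evalHom K m α g) :=
  algHom_ext (by simp)

theorem evalMod_eq_zero_iff (α : m.adicCompletionIntegers K) (f : IntPoly D K) :
    evalMod K m α f = 0 ↔ Valued.v (evalHom K m α f : m.adicCompletion K) < 1 := by
  rw [← mem_map_asIdeal_iff, ← Ideal.Quotient.eq_zero_iff_mem]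
  exact (AlgEquiv.ofBijective (residueHom K m) (residueHom_bijective K m)).symm.map_eq_zero_iff

variable {K}

/-- The polynomial `∏ (X - c)`, where `c` runs over representatives of the residue classes
modulo `m`. -/
theorem exists_residue_product [Finite (D ⧸ m.asIdeal)] : ∃ p : D[X],
    (∀ d : D, p.eval d ∈ m.asIdeal) ∧ p.eval 0 = 0 ∧
    ∀ α : m.adicCompletionIntegers K, Valued.v (α : m.adicCompletion K) < 1 →
      Valued.v (aeval α p : m.adicCompletionIntegers K).1 = Valued.v (α : m.adicCompletion K) := by
  classical
  have := Fintype.ofFinite (D ⧸ m.asIdeal)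
  let c : D ⧸ m.asIdeal → D := fun r => Quotient.out r
  have hc : ∀ r, Ideal.Quotient.mk m.asIdeal (c r) = r := fun r => Ideal.Quotient.mk_out r
  -- The zero class is represented by `0` itself, not by `c 0`, so that `p(0) = 0` and `X` carries
  -- the whole valuation at points of `m D̂_m`; the other factors are units there.
  refine ⟨X * ∏ r ∈ Finset.univ.erase 0, (X - C (c r)), fun d => ?_, by simp, fun α hα => ?_⟩
  · rw [← Ideal.Quotient.eq_zero_iff_mem, eval_mul, eval_prod, map_mul, map_prod, eval_X]
    by_cases h : Ideal.Quotient.mk m.asIdeal d = 0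
    · rw [h, zero_mul]
    · rw [Finset.prod_eq_zero (i := Ideal.Quotient.mk m.asIdeal d) (by simp [h]) (by simp [hc]),
        mul_zero]
  · rw [map_mul, aeval_X, map_prod]
    simp only [MulMemClass.coe_mul, SubmonoidClass.coe_finsetProd, map_mul, map_prod]
    rw [Finset.prod_eq_one, mul_one]
    intro r hr
    have hcr : c r ∉ m.asIdeal := by
      rw [← Ideal.Quotient.eq_zero_iff_mem, hc]
      simpa using hr
    have h1 := (valued_algebraMap_eq_one_iff K m (c r)).2 hcr
    have h2 : ((aeval α (X - C (c r)) : m.adicCompletionIntegers K) : m.adicCompletion K) =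
        α - algebraMap D (m.adicCompletion K) (c r) := by
      simp
      rfl
    rw [h2, Valuation.map_sub_eq_of_lt_right, h1]
    rwa [h1]

/-- An integer-valued polynomial that vanishes at `0` and divides the elements of `m D̂_m` by a
uniformizer, up to units. -/
theorem exists_evalAt_zero_valued_mul [Finite (D ⧸ m.asIdeal)] : ∃ h : IntPoly D K,
    evalAt K 0 h = 0 ∧ ∀ α : m.adicCompletionIntegers K, Valued.v (α : m.adicCompletion K) < 1 →
      WithZero.exp (-1 : ℤ) * Valued.v (evalHom K m α h : m.adicCompletion K) =
        Valued.v (α : m.adicCompletion K) := by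
  obtain ⟨π, e, hπ, he, hdvd⟩ := m.exists_uniformizer_mul_dvd
  obtain ⟨p, hp, hp0, hpv⟩ := exists_residue_product (K := K) m
  have hπ0 : π ≠ 0 := fun h => by
    rw [h, map_zero] at hπ
    exact WithZero.exp_ne_zero hπ.symm
  -- Here `h = e p / π`. As `m` need not be principal, `p / π` alone may fail to be integer-valued;
  -- the factor `e` repairs this and is a unit at `m`.
  obtain ⟨h, hh⟩ := exists_smul_eq_of_dvd_evalAt hπ0 (e • ofPolynomial D K p) fun d => by
    rw [map_smul, evalAt_ofPolynomial]
    exact hdvd _ (hp d)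
  refine ⟨h, ?_, fun α hα => ?_⟩
  · have h2 := congrArg (evalAt K 0) hh
    rw [map_smul, map_smul, evalAt_ofPolynomial, hp0, smul_zero] at h2
    exact (smul_eq_zero_iff_right hπ0).1 h2
  · have h2 := congrArg (fun f => Valued.v (evalHom K m α f : m.adicCompletion K)) hh
    simp only [evalHom_ofPolynomial, AlgHom.commutes, Algebra.smul_def, MulMemClass.coe_mul, map_mul,
      hpv α hα] at h2
    change Valued.v (algebraMap D (m.adicCompletion K) π) * _ =
      Valued.v (algebraMap D (m.adicCompletion K) e) * _ at h2
    rw [← hπ, ← valued_algebraMap_eq_intValuation K, h2,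
      (valued_algebraMap_eq_one_iff K m e).2 he, one_mul]

/-- Integer-valued polynomials separate the points of `D̂_m` modulo `m`. -/
theorem exists_evalMod_ne_zero [Finite (D ⧸ m.asIdeal)] {α : m.adicCompletionIntegers K}
    (hα : α ≠ 0) : ∃ f : IntPoly D K, evalAt K 0 f = 0 ∧ evalMod K m α f ≠ 0 := by
  obtain ⟨h, h0, hv⟩ := exists_evalAt_zero_valued_mul (K := K) m
  -- Induction on the order `n` of `α`: `h(α)` has order one less, so if `f` works for `h(α)`, then
  -- `f ∘ h` works for `α`. The condition `h(0) = 0` preserves vanishing at `0`.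
  have key : ∀ (n : ℕ) (α : m.adicCompletionIntegers K),
      Valued.v (α : m.adicCompletion K) = WithZero.exp (-1 : ℤ) ^ n →
      ∃ f : IntPoly D K, evalAt K 0 f = 0 ∧
        Valued.v (evalHom K m α f : m.adicCompletion K) = 1 := by
    intro n
    induction n with
    | zero =>
      intro α hα
      exact ⟨ofPolynomial D K X, by simp, by simpa using hα⟩
    | succ n ih =>
      intro α hα
      have hlt : Valued.v (α : m.adicCompletion K) < 1 := by
        rw [hα, ← WithZero.exp_nsmul, ← WithZero.exp_zero, WithZero.exp_lt_exp, nsmul_eq_mul]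
        push_cast
        omega
      obtain ⟨f, hf0, hf⟩ := ih (evalHom K m α h) (by
        have h2 := hv α hlt
        rw [hα, pow_succ'] at h2
        exact mul_left_cancel₀ WithZero.exp_ne_zero h2)
      refine ⟨compRight h f, ?_, ?_⟩
      · have h2 : (evalAt K 0).comp (compRight h) = evalAt K (evalAt K 0 h) :=
          algHom_ext (by simp)
        rw [← AlgHom.comp_apply, h2, h0, hf0]
      · rwa [← AlgHom.comp_apply, evalHom_compRight]
  have hv0 : Valued.v (α : m.adicCompletion K) ≠ 0 := by
    rw [Valuation.ne_zero_iff]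
    exact fun h => hα (Subtype.ext h)
  have hle : Valued.v (α : m.adicCompletion K) ≤ 1 := α.2
  rw [← WithZero.exp_log hv0, ← WithZero.exp_zero, WithZero.exp_le_exp] at hle
  obtain ⟨f, hf0, hf⟩ := key (-WithZero.log (Valued.v (α : m.adicCompletion K))).toNat α (by
    rw [← WithZero.exp_nsmul, nsmul_eq_mul]
    conv_lhs => rw [← WithZero.exp_log hv0]
    congr 1
    omega)
  refine ⟨f, hf0, ?_⟩
  rw [Ne, evalMod_eq_zero_iff, hf]
  exact lt_irrefl _

/-! ### Homomorphisms to domains over the residue field -/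

section Domain

variable {m} {A : Type*} [CommRing A] [IsDomain A] [Algebra D A]

theorem algebraMap_eq_zero_iff_mem (hA : m.asIdeal.map (algebraMap D A) = ⊥) (d : D) :
    algebraMap D A d = 0 ↔ d ∈ m.asIdeal := by
  have hle : m.asIdeal ≤ RingHom.ker (algebraMap D A) := fun x hx => by
    rw [RingHom.mem_ker, ← Ideal.mem_bot, ← hA]
    exact Ideal.mem_map_of_mem _ hx
  rw [← RingHom.mem_ker, ← m.isMaximal.eq_of_le (RingHom.ker_ne_top _) hle]

theorem quotientToAlgebra_injective (hA : m.asIdeal.map (algebraMap D A) = ⊥) :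
    Function.Injective (quotientToAlgebra m.asIdeal A hA) := by
  rw [injective_iff_map_eq_zero]
  intro x hx
  obtain ⟨d, rfl⟩ := Ideal.Quotient.mk_surjective x
  change algebraMap D A d = 0 at hx
  rw [algebraMap_eq_zero_iff_mem hA] at hx
  exact Ideal.Quotient.eq_zero_iff_mem.2 hx

/-- Polynomials with values in `m` are killed by all homomorphisms to domains over `D / m`. -/
theorem algHom_eq_zero_of_forall_evalAt_mem (hA : m.asIdeal.map (algebraMap D A) = ⊥)
    (φ : IntPoly D K →ₐ[D] A) {f : IntPoly D K} (hf : ∀ d, evalAt K d f ∈ m.asIdeal) :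
    φ f = 0 := by
  obtain ⟨π, e, hπ, he, hdvd⟩ := m.exists_uniformizer_mul_dvd
  have hπ0 : π ≠ 0 := fun h => by
    rw [h, map_zero] at hπ
    exact WithZero.exp_ne_zero hπ.symm
  have hmem : π ∈ m.asIdeal := by
    rw [← intValuation_lt_one_iff_mem, hπ, ← WithZero.exp_zero, WithZero.exp_lt_exp]
    norm_num
  -- From `e f = π g`, applying `φ` kills the right side, while the image of `e` in the domain `A`
  -- is nonzero.
  obtain ⟨g, hg⟩ := exists_smul_eq_of_dvd_evalAt hπ0 (e • f) fun d => by
    rw [map_smul]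
    exact hdvd _ (hf d)
  have h2 := congrArg φ hg
  rw [map_smul, map_smul, Algebra.smul_def, Algebra.smul_def,
    (algebraMap_eq_zero_iff_mem hA π).2 hmem, zero_mul, eq_comm, mul_eq_zero] at h2
  exact h2.resolve_left fun h => he ((algebraMap_eq_zero_iff_mem hA e).1 h)

variable [Finite (D ⧸ m.asIdeal)]

/-- The product of `f - c` over residue representatives `c` has values in `m`, so `φ` kills it, and
hence one of its factors since `A` is a domain. -/
theorem exists_algHom_eq_algebraMap (hA : m.asIdeal.map (algebraMap D A) = ⊥)
    (φ : IntPoly D K →ₐ[D] A) (f : IntPoly D K) : ∃ c : D, φ f = algebraMap D A c := by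
  have := Fintype.ofFinite (D ⧸ m.asIdeal)
  have h := algHom_eq_zero_of_forall_evalAt_mem hA φ
    (f := ∏ r : D ⧸ m.asIdeal, (f - algebraMap D _ (Quotient.out r))) fun d => by
      rw [← Ideal.Quotient.eq_zero_iff_mem, map_prod, map_prod]
      refine Finset.prod_eq_zero (i := Ideal.Quotient.mk m.asIdeal (evalAt K d f))
        (Finset.mem_univ _) ?_
      rw [map_sub, AlgHom.commutes, map_sub, sub_eq_zero]
      exact (Ideal.Quotient.mk_out _).symm
  rw [map_prod, Finset.prod_eq_zero_iff] at h
  obtain ⟨r, -, hr⟩ := h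
  rw [map_sub, AlgHom.commutes, sub_eq_zero] at hr
  exact ⟨_, hr⟩

/-- Finitely many elements of the kernel of a homomorphism have a common zero modulo `m`. -/
theorem exists_forall_evalAt_mem (hA : m.asIdeal.map (algebraMap D A) = ⊥)
    (φ : IntPoly D K →ₐ[D] A) (s : Finset (IntPoly D K)) (hs : ∀ f ∈ s, φ f = 0) :
    ∃ a : D, ∀ f ∈ s, evalAt K a f ∈ m.asIdeal := by
  have := Fintype.ofFinite (D ⧸ m.asIdeal)
  let _ := Ideal.Quotient.field m.asIdeal
  by_contra! hcon
  -- Without a common zero modulo `m`, Fermat's little theorem puts every value of this product in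
  -- `m`, so `φ` kills it; but `φ` sends each factor to `1`.
  have h := algHom_eq_zero_of_forall_evalAt_mem hA φ
    (f := ∏ f ∈ s, (1 - f ^ (Fintype.card (D ⧸ m.asIdeal) - 1))) fun d => by
      obtain ⟨f, hf, hfd⟩ := hcon d
      rw [← Ideal.Quotient.eq_zero_iff_mem, map_prod, map_prod]
      refine Finset.prod_eq_zero hf ?_
      rw [map_sub, map_sub, map_one, map_one, map_pow, map_pow,
        FiniteField.pow_card_sub_one_eq_one _ (by rwa [Ne, Ideal.Quotient.eq_zero_iff_mem]),
        sub_self]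
  rw [map_prod, Finset.prod_eq_one] at h
  · exact one_ne_zero h
  · intro f hf
    rw [map_sub, map_one, map_pow, hs f hf, zero_pow, sub_zero]
    exact Nat.sub_ne_zero_of_lt Fintype.one_lt_card

/-- The closed conditions `v(f(α)) < 1`, for `f` in `ker φ`, have the finite intersection property
on a compact set. A common point `α` recovers `φ`, because `f - c` lies in `ker φ` for some `c ∈ D`.
-/
theorem exists_eq_comp_evalMod (hA : m.asIdeal.map (algebraMap D A) = ⊥)
    (φ : IntPoly D K →ₐ[D] A) :
    ∃ α, (quotientToAlgebra m.asIdeal A hA).comp (evalMod K m α) = φ := by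
  obtain ⟨α, hα, hαφ⟩ := (isCompact_adicCompletionIntegers K m).inter_iInter_nonempty
    (fun f : {f : IntPoly D K // φ f = 0} =>
      {x : m.adicCompletion K | Valued.v (aeval x (f.1 : K[X])) < 1})
    (fun f => by
      have h := (Valued.isClosed_ball (m.adicCompletion K) 1).preimage
        (Polynomial.continuous_aeval (f.1 : K[X]))
      simpa only [Set.preimage_ofPred_eq, Valuation.restrict_lt_one_iff] using h)
    (fun u => by
      obtain ⟨a, ha⟩ := exists_forall_evalAt_mem hA φ (u.map (Function.Embedding.subtype _))
        (by simp +contextual)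
      refine ⟨algebraMap D (m.adicCompletion K) a, coe_mem_adicCompletionIntegers m a,
        Set.mem_iInter₂.2 fun f hf => ?_⟩
      have h2 := (valued_algebraMap_lt_one_iff K m _).2
        (ha f.1 (Finset.mem_map_of_mem (Function.Embedding.subtype _) hf))
      rwa [IsScalarTower.algebraMap_apply D K, algebraMap_evalAt, ← coe_aeval_eq_eval,
        ← aeval_algebraMap_apply, ← IsScalarTower.algebraMap_apply] at h2)
  refine ⟨⟨α, hα⟩, AlgHom.ext fun f => ?_⟩
  obtain ⟨c, hc⟩ := exists_algHom_eq_algebraMap hA φ f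
  have h0 : φ (f - algebraMap D _ c) = 0 := by
    rw [map_sub, hc, AlgHom.commutes, sub_self]
  have h1 : evalMod K m ⟨α, hα⟩ (f - algebraMap D _ c) = 0 :=
    (evalMod_eq_zero_iff K m _ _).2 (Set.mem_iInter.1 hαφ ⟨_, h0⟩)
  rw [map_sub, AlgHom.commutes, sub_eq_zero] at h1
  rw [AlgHom.comp_apply, h1, AlgHom.commutes, hc]

end Domain

/-! ### The isomorphism with the points of the biring -/

section Points

variable {P : Biring D D (IntPoly D K)}

variable {m} in
/-- The homomorphism `D̂_m → Hom_D(Int(D), R)`, `α ↦ (f ↦ g(f(α)))`, for a homomorphism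
`g : D̂_m → R`. -/
noncomputable def evalPoints (hP : IsCompatible P) {R : Type*} [CommRing R] [Algebra D R]
    (g : m.adicCompletionIntegers K →ₐ[D] R) : m.adicCompletionIntegers K →ₐ[D] P.Points R where
  toFun α := ⟨g.comp (evalHom K m α)⟩
  map_zero' := by
    have h : evalHom K m 0 = (Algebra.ofId D _).comp P.cozero :=
      algHom_ext (by simp [hP.cozero_X])
    refine Biring.Points.ext ?_
    change g.comp (evalHom K m 0) = (Algebra.ofId D R).comp P.cozero
    rw [h, ← AlgHom.comp_assoc]
    congr 1
    ext
  map_one' := by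
    have h : evalHom K m 1 = (Algebra.ofId D _).comp P.counit :=
      algHom_ext (by simp [hP.counit_X])
    refine Biring.Points.ext ?_
    change g.comp (evalHom K m 1) = (Algebra.ofId D R).comp P.counit
    rw [h, ← AlgHom.comp_assoc]
    congr 1
    ext
  map_add' α β := by
    have h : evalHom K m (α + β) = coOp P.coadd (evalHom K m α) (evalHom K m β) :=
      algHom_ext (by simp [coOp, hP.coadd_X])
    refine Biring.Points.ext ?_
    change g.comp (evalHom K m (α + β)) =
      coOp P.coadd (g.comp (evalHom K m α)) (g.comp (evalHom K m β))
    rw [h, Biring.comp_coOp]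
  map_mul' α β := by
    have h : evalHom K m (α * β) = coOp P.comul (evalHom K m α) (evalHom K m β) :=
      algHom_ext (by simp [coOp, hP.comul_X])
    refine Biring.Points.ext ?_
    change g.comp (evalHom K m (α * β)) =
      coOp P.comul (g.comp (evalHom K m α)) (g.comp (evalHom K m β))
    rw [h, Biring.comp_coOp]
  commutes' d := by
    have h : evalHom K m (algebraMap D _ d) = (Algebra.ofId D _).comp (P.colin d) :=
      algHom_ext (by simp [hP.colin_X, Algebra.ofId_apply])
    refine Biring.Points.ext ?_
    change g.comp (evalHom K m (algebraMap D _ d)) = (Algebra.ofId D R).comp (P.colin d)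
    rw [h, ← AlgHom.comp_assoc]
    congr 1
    ext

theorem exists_algEquiv_points [Finite (D ⧸ m.asIdeal)] (hP : IsCompatible P) {A : Type*}
    [CommRing A] [IsDomain A] [Algebra D A] (hA : m.asIdeal.map (algebraMap D A) = ⊥) :
    ∃ Θ : m.adicCompletionIntegers K ≃ₐ[D] P.Points A,
      ∀ α, (Θ α).toAlgHom = (quotientToAlgebra m.asIdeal A hA).comp (evalMod K m α) := by
  let g : m.adicCompletionIntegers K →ₐ[D] D ⧸ m.asIdeal :=
    (AlgEquiv.ofBijective (residueHom K m) (residueHom_bijective K m)).symm.toAlgHom.comp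
      (Ideal.Quotient.mkₐ D (m.asIdeal.map (algebraMap D (m.adicCompletionIntegers K))))
  let Θ := evalPoints hP ((quotientToAlgebra m.asIdeal A hA).comp g)
  have hΘ : ∀ α, (Θ α).toAlgHom = (quotientToAlgebra m.asIdeal A hA).comp (evalMod K m α) :=
    fun _ => rfl
  refine ⟨AlgEquiv.ofBijective Θ ⟨?_, fun φ => ?_⟩, hΘ⟩
  · rw [injective_iff_map_eq_zero]
    intro α hα
    by_contra hne
    obtain ⟨f, hf0, hf⟩ := exists_evalMod_ne_zero m hne
    refine hf (quotientToAlgebra_injective hA ?_)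
    -- Zero is written as the image of `0 : D` so that evaluation there reduces to `evalAt K 0 f =
    -- 0`.
    have h1 : (Θ α).toAlgHom f = (Θ (algebraMap D _ 0)).toAlgHom f := by
      rw [hα, map_zero, map_zero]
    have h2 : evalMod K m (algebraMap D _ 0) f = 0 := by
      rw [evalMod_eq_zero_iff, evalHom_algebraMap, AlgHom.comp_apply, hf0, map_zero]
      simp
    rw [hΘ, hΘ, AlgHom.comp_apply, AlgHom.comp_apply, h2] at h1
    exact h1
  · obtain ⟨α, hα⟩ := exists_eq_comp_evalMod hA φ.toAlgHom
    exact ⟨α, Biring.Points.ext hα⟩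

end Points

end IntPoly

/-! ### The biring and the triangle of isomorphisms -/

theorem mainTheorem6 {D : Type*} [CommRing D] [IsDedekindDomain D]
    (K : Type*) [Field K] [Algebra D K] [IsFractionRing D K]
    (m : IsDedekindDomain.HeightOneSpectrum D) [Finite (D ⧸ m.asIdeal)] :
    (∃! P : Biring D D (IntPoly D K), IntPoly.IsCompatible P) ∧
    ∀ P : Biring D D (IntPoly D K), IntPoly.IsCompatible P →
      ∃ Φ : m.adicCompletionIntegers K ≃ₐ[D] P.Points (D ⧸ m.asIdeal),
        (∀ α, (Φ α).toAlgHom = IntPoly.evalMod K m α) ∧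
        ∀ (A : Type*) [CommRing A] [IsDomain A] [Algebra D A]
          (hA : m.asIdeal.map (algebraMap D A) = ⊥),
          ∃ (Ψ : P.Points (D ⧸ m.asIdeal) ≃ₐ[D] P.Points A)
            (Θ : m.adicCompletionIntegers K ≃ₐ[D] P.Points A),
            (∀ φ, (Ψ φ).toAlgHom = (quotientToAlgebra m.asIdeal A hA).comp φ.toAlgHom) ∧
            (∀ α, (Θ α).toAlgHom =
              (quotientToAlgebra m.asIdeal A hA).comp (IntPoly.evalMod K m α)) ∧
            ∀ α, Θ α = Ψ (Φ α) := by
  have : Infinite D := m.infinite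
  refine ⟨?_, fun P hP => ?_⟩
  · obtain ⟨P, hP⟩ := IntPoly.exists_isCompatible (D := D) (K := K)
    exact ⟨P, hP, fun Q hQ => hQ.eq hP⟩
  have hk : m.asIdeal.map (algebraMap D (D ⧸ m.asIdeal)) = ⊥ := Ideal.map_quotient_self m.asIdeal
  obtain ⟨Φ, hΦ⟩ := IntPoly.exists_algEquiv_points m hP hk
  have hid : quotientToAlgebra m.asIdeal (D ⧸ m.asIdeal) hk = AlgHom.id D _ :=
    Ideal.Quotient.algHom_ext _ (Subsingleton.elim _ _)
  simp only [hid, AlgHom.id_comp] at hΦ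
  refine ⟨Φ, hΦ, fun A _ _ _ hA => ?_⟩
  obtain ⟨Θ, hΘ⟩ := IntPoly.exists_algEquiv_points m hP hA
  -- Defining `Ψ` through the other two sides makes it bijective and the triangle commute at once;
  -- that it is composition with the structure map follows from the formulas for `Φ` and `Θ`.
  refine ⟨Φ.symm.trans Θ, Θ, fun φ => ?_, hΘ, fun α => by simp⟩
  rw [AlgEquiv.trans_apply, hΘ, ← hΦ, AlgEquiv.apply_symm_apply]
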